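/- Let $p\in(1,2)$. There are constants $c_p,C_p>0$, depending only on $p$, such that the following holds. Let $n,m\in\mathbb N$, let $\xi_1,\dots,\xi_n$ be independent standard Gaussian random variables on a probability space $(\Omega_1,\mathfrak A_1,\mathbb P_1)$, and let $\eta_1,\dots,\eta_m$ be independent, identically distributed symmetric $p$-stable random variables with scale parameter $\sigma>0$ on a probability space $(\Omega_2,\mathfrak A_2,\mathbb P_2)$, i.e. $\mathbb E\,e^{it\eta_j}=e^{-\sigma^p|t|^p}$ for all $t\in\mathbb R$. Then for every real matrix $(a_{ij})\in\mathbb R^{n\times m}$ the function $(\omega_1,\omega_2)\mapsto\max_{i,j}|a_{ij}\eta_j(\omega_2)\xi_i(\omega_1)|$ is integrable with respect to $\mathbb P_1\otimes\mathbb P_2$, and $$c_p\,\sigma\,\Big\|\big(\|(a_{ij})_{i=1}^n\|_{M}\big)_{j=1}^m\Big\|_p\;\le\;\mathbb E_{\Omega_1}\mathbb E_{\Omega_2}\max_{i,j}\big|a_{ij}\,\eta_j(\omega_2)\,\xi_i(\omega_1)\big|\;\le\; C_p\,\sigma\,\Big\|\big(\|(a_{ij})_{i=1}^n\|_{M}\big)_{j=1}^m\Big\|_p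 .$$ In particular, for standard $p$-stable variables ($\sigma=1$) the two sides are equivalent up to constants depending only on $p$. Here $M:[0,\infty)\to[0,\infty)$ is the Orlicz function $$M(s)=\begin{cases}0,& s=0,\\ e^{-\frac{3}{2s^2}},& s\in(0,1),\\ e^{-\frac32}(3s-2),& s\ge 1,\end{cases}$$ $\|x\|_M=\inf\{t>0:\sum_{i=1}^n M(|x_i|/t)\le 1\}$ for $x\in\mathbb R^n$ is the associated Orlicz norm, and $\|y\|_p=\big(\sum_{j=1}^m|y_j|^p\big)^{1/p}$. -/

import Mathlib

open MeasureTheory ProbabilityTheory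

noncomputable section

namespace StableGauss

/-- `X` is a symmetric `p`-stable random variable with scale parameter `σ`, that is,
its characteristic function is `t ↦ exp (-σ^p |t|^p)`. -/
def IsSymmStable {Ω : Type*} [MeasurableSpace Ω] (p σ : ℝ) (X : Ω → ℝ) (P : Measure Ω) : Prop :=
  Measurable X ∧ ∀ t : ℝ, charFun (P.map X) t = ((Real.exp (-(σ * |t|) ^ p) : ℝ) : ℂ)

/-- The Orlicz function `M` on `[0, ∞)`; it is only ever evaluated at nonnegative arguments. -/
def gaussOrlicz (s : ℝ) : ℝ :=
  if s = 0 then 0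
  else if s < 1 then Real.exp (-3 / (2 * s ^ 2))
  else Real.exp (-3 / 2) * (3 * s - 2)

/-- The Orlicz (Luxemburg) norm on `ℝⁿ` given by `M`. -/
def orliczNorm {n : ℕ} (M : ℝ → ℝ) (x : Fin n → ℝ) : ℝ :=
  sInf {t : ℝ | 0 < t ∧ ∑ i, M (|x i| / t) ≤ 1}

/-- The function `(ω₁, ω₂) ↦ max_{i,j} |a_{ij} η_j(ω₂) ξ_i(ω₁)|`. -/
def maxProd {Ω₁ Ω₂ : Type*} {n m : ℕ} (a : Matrix (Fin n) (Fin m) ℝ)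
    (ξ : Fin n → Ω₁ → ℝ) (η : Fin m → Ω₂ → ℝ) (ω₁ : Ω₁) (ω₂ : Ω₂) : ℝ :=
  ⨆ ij : Fin n × Fin m, |a ij.1 ij.2 * η ij.2 ω₂ * ξ ij.1 ω₁|

end StableGauss

end

/-! Freeze `ω₁` and put `G j = max_i |a i j * ξ i|`. The maximum becomes `max_j G j * |η j|`, a
maximum of stable variables with deterministic weights. A standard stable tail is comparable to `r ^
(-p)` for `r ≥ 1`, so the expected maximum of `|x j * η j|` is comparable to the `ℓ_p` norm of `x`
(`integral_iSup_stable_le`, `exists_le_integral_iSup_stable`). It remains to estimate the expected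
`ℓ_p` norm of the random vector `G`.

That expectation lies between `‖(E G j)_j‖_p` (the norm of a Bochner integral is at most the
integral of the norm) and `(∑ j, E (G j) ^ p) ^ (1 / p)` (Jensen). Both ends are comparable to the
`ℓ_p` norm of the Orlicz norms: the first moment of a Gaussian maximum is bounded below by the
Orlicz norm (`exists_le_integral_iSup_gaussian`), and its `p`-th moment is bounded above by the
`p`-th power of that norm (`integral_iSup_gaussian_rpow_le`).

All four estimates compare a maximum with a threshold. Upper bounds add up the excesses above it.
Lower bounds show that it is exceeded with probability bounded below, and only there does
independence enter. -/

namespace StableGauss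

/-! ### Tails and truncated moments of a standard stable law, from its characteristic function. -/

section StableTails

variable {p : ℝ} {μ : Measure ℝ} [IsProbabilityMeasure μ]

/-- Upper tail bound for a standard symmetric `p`-stable law. -/
theorem stable_tail_le (hp : 1 < p) (hp' : p < 2)
    (hμ : ∀ t : ℝ, charFun μ t = ((Real.exp (-|t| ^ p) : ℝ) : ℂ)) {r : ℝ} (hr : 0 < r) :
    μ.real {x | r < |x|} ≤ 8 * r ^ (-p) := by
  -- The tail is controlled by the average of `1 - charFun μ` near `0`, where `0 ≤ 1 - exp (-|t| ^
  -- p) ≤ |t| ^ p`.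
  have hb : ‖∫ t in (-2 * r⁻¹)..(2 * r⁻¹), 1 - charFun μ t‖
      ≤ (2 * r⁻¹) ^ p * |2 * r⁻¹ - (-2 * r⁻¹)| := by
    refine intervalIntegral.norm_integral_le_of_norm_le_const fun t ht ↦ ?_
    have hri : 0 < r⁻¹ := inv_pos.mpr hr
    rw [Set.uIoc_of_le (by linarith)] at ht
    have ht' : |t| ≤ 2 * r⁻¹ := abs_le.mpr ⟨by linarith [ht.1], ht.2⟩
    have h0 : |t| ^ p ≤ (2 * r⁻¹) ^ p := Real.rpow_le_rpow (abs_nonneg t) ht' (by linarith)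
    have h1 : 0 ≤ |t| ^ p := by positivity
    rw [hμ, ← Complex.ofReal_one, ← Complex.ofReal_sub, Complex.norm_real, Real.norm_eq_abs,
      abs_of_nonneg (by simpa using h1)]
    linarith [Real.one_sub_le_exp_neg (|t| ^ p)]
  have h2p : (2 : ℝ) ^ p ≤ 4 := by
    calc (2 : ℝ) ^ p ≤ 2 ^ (2 : ℝ) := Real.rpow_le_rpow_of_exponent_le (by norm_num) hp'.le
      _ = 4 := by norm_num
  have hrp : 0 < r ^ (-p) := Real.rpow_pos_of_pos hr _
  calc μ.real {x | r < |x|}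
      ≤ 2⁻¹ * r * ‖∫ t in (-2 * r⁻¹)..(2 * r⁻¹), 1 - charFun μ t‖ :=
        measureReal_abs_gt_le_integral_charFun hr
    _ ≤ 2⁻¹ * r * ((2 * r⁻¹) ^ p * |2 * r⁻¹ - (-2 * r⁻¹)|) := by gcongr
    _ = 2 * (2 ^ p * r ^ (-p)) := by
        rw [Real.mul_rpow (by norm_num) (by positivity), Real.inv_rpow hr.le,
          ← Real.rpow_neg hr.le, abs_of_nonneg (by have := inv_pos.mpr hr; linarith)]
        field_simp
        ring
    _ ≤ 8 * r ^ (-p) := by nlinarith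

theorem stable_measure_tail_le (hp : 1 < p) (hp' : p < 2)
    (hμ : ∀ t : ℝ, charFun μ t = ((Real.exp (-|t| ^ p) : ℝ) : ℂ)) {r : ℝ} (hr : 0 < r) :
    μ {x | r < |x|} ≤ ENNReal.ofReal (8 * r ^ (-p)) := by
  rw [← ofReal_measureReal]
  exact ENNReal.ofReal_le_ofReal (stable_tail_le hp hp' hμ hr)

theorem integral_Ioi_add_rpow_neg (hp : 1 < p) {s : ℝ} (hs : 0 < s) :
    ∫ t in Set.Ioi (0 : ℝ), (t + s) ^ (-p) = s ^ (1 - p) / (p - 1) := by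
  have hd : ∀ x ∈ Set.Ici (0 : ℝ),
      HasDerivAt (fun t ↦ (t + s) ^ (1 - p) / (1 - p)) ((x + s) ^ (-p)) x := by
    intro x hx
    have hx0 : x + s ≠ 0 := by have : (0 : ℝ) ≤ x := hx; positivity
    have := (((hasDerivAt_id x).add_const s).rpow_const (p := 1 - p) (Or.inl hx0)).div_const (1 - p)
    convert! this using 1
    have : 1 - p ≠ 0 := by linarith
    simp only [id, show 1 - p - 1 = -p by ring]
    field_simp
  have ht : Filter.Tendsto (fun t : ℝ ↦ (t + s) ^ (1 - p) / (1 - p)) Filter.atTop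
      (nhds (0 / (1 - p))) := by
    apply Filter.Tendsto.div_const
    have h := (tendsto_rpow_neg_atTop (y := p - 1) (by linarith)).comp
      (Filter.tendsto_atTop_add_const_right _ s Filter.tendsto_id)
    simpa only [neg_sub, Function.comp_def, id] using h
  have hi := integrableOn_add_rpow_Ioi_of_lt (a := -p) (c := 0) (m := s) (by linarith)
    (by linarith)
  rw [integral_Ioi_of_hasDerivAt_of_tendsto' hd hi ht, zero_add, zero_div, zero_sub, ← div_neg,
    neg_sub]

/-- The mean excess of a stable variable above the level `s`. -/
theorem stable_lintegral_excess_le (hp : 1 < p) (hp' : p < 2)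
    (hμ : ∀ t : ℝ, charFun μ t = ((Real.exp (-|t| ^ p) : ℝ) : ℂ)) {s : ℝ} (hs : 0 < s) :
    ∫⁻ x, ENNReal.ofReal (max (|x| - s) 0) ∂μ
      ≤ ENNReal.ofReal (8 / (p - 1) * s ^ (1 - p)) := by
  have hi := integrableOn_add_rpow_Ioi_of_lt (a := -p) (c := 0) (m := s) (by linarith)
    (by linarith)
  -- Layer cake: the excess is larger than `t` exactly when `|x|` is larger than `t + s`.
  rw [lintegral_eq_lintegral_meas_lt μ (f := fun x ↦ max (|x| - s) 0)
    (ae_of_all μ fun x ↦ le_max_right (|x| - s) 0)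
    (by fun_prop)]
  calc ∫⁻ t in Set.Ioi (0 : ℝ), μ {x | t < max (|x| - s) 0}
      ≤ ∫⁻ t in Set.Ioi (0 : ℝ), ENNReal.ofReal (8 * (t + s) ^ (-p)) := by
        refine setLIntegral_mono' measurableSet_Ioi fun t ht ↦ ?_
        have ht' : (0 : ℝ) < t := ht
        refine (measure_mono fun x hx ↦ ?_).trans
          (stable_measure_tail_le hp hp' hμ (r := t + s) (by linarith))
        rcases lt_max_iff.mp (show t < max (|x| - s) 0 from hx) with h | h
        · show t + s < |x|
          linarith
        · linarith
    _ = ENNReal.ofReal (∫ t in Set.Ioi (0 : ℝ), 8 * (t + s) ^ (-p)) := by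
        rw [ofReal_integral_eq_lintegral_ofReal (hi.const_mul 8)]
        refine (ae_restrict_iff' measurableSet_Ioi).mpr (ae_of_all _ fun t ht ↦ ?_)
        have ht' : (0 : ℝ) < t := ht
        show (0 : ℝ) ≤ 8 * (t + s) ^ (-p)
        positivity
    _ = ENNReal.ofReal (8 / (p - 1) * s ^ (1 - p)) := by
        rw [integral_const_mul, integral_Ioi_add_rpow_neg hp hs]
        congr 1
        ring

theorem stable_integrable_excess (hp : 1 < p) (hp' : p < 2)
    (hμ : ∀ t : ℝ, charFun μ t = ((Real.exp (-|t| ^ p) : ℝ) : ℂ)) {s : ℝ} (hs : 0 < s) :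
    Integrable (fun x ↦ max (|x| - s) 0) μ := by
  refine ⟨by fun_prop, ?_⟩
  rw [hasFiniteIntegral_iff_ofReal (f := fun x ↦ max (|x| - s) 0)
    (ae_of_all μ fun x ↦ le_max_right (|x| - s) 0)]
  exact (stable_lintegral_excess_le hp hp' hμ hs).trans_lt ENNReal.ofReal_lt_top

theorem stable_integral_excess_le (hp : 1 < p) (hp' : p < 2)
    (hμ : ∀ t : ℝ, charFun μ t = ((Real.exp (-|t| ^ p) : ℝ) : ℂ)) {s : ℝ} (hs : 0 < s) :
    ∫ x, max (|x| - s) 0 ∂μ ≤ 8 / (p - 1) * s ^ (1 - p) := by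
  rw [integral_eq_lintegral_of_nonneg_ae (f := fun x ↦ max (|x| - s) 0)
    (ae_of_all μ fun x ↦ le_max_right (|x| - s) 0) (by fun_prop)]
  refine ENNReal.toReal_le_of_le_ofReal ?_ (stable_lintegral_excess_le hp hp' hμ hs)
  have : 0 < p - 1 := by linarith
  positivity

theorem stable_integrable_id (hp : 1 < p) (hp' : p < 2)
    (hμ : ∀ t : ℝ, charFun μ t = ((Real.exp (-|t| ^ p) : ℝ) : ℂ)) :
    Integrable (fun x : ℝ ↦ x) μ := by
  refine ((stable_integrable_excess hp hp' hμ one_pos).add (integrable_const (1 : ℝ))).mono'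
    (by fun_prop) (ae_of_all _ fun x ↦ ?_)
  show |x| ≤ max (|x| - 1) 0 + 1
  linarith [le_max_left (|x| - 1) 0]

/-- Truncated second moment of a stable variable. -/
theorem stable_integral_min_sq_le (hp : 1 < p) (hp' : p < 2)
    (hμ : ∀ t : ℝ, charFun μ t = ((Real.exp (-|t| ^ p) : ℝ) : ℂ)) {R : ℝ} (hR : 0 < R) :
    ∫ x, (min |x| R) ^ 2 ∂μ ≤ 16 / (2 - p) * R ^ (2 - p) := by
  have hp2 : 0 < 2 - p := by linarith
  rw [integral_eq_lintegral_of_nonneg_ae (ae_of_all _ fun x ↦ by positivity) (by fun_prop)]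
  refine ENNReal.toReal_le_of_le_ofReal (by positivity) ?_
  have h := lintegral_rpow_eq_lintegral_meas_lt_mul μ (f := fun x : ℝ ↦ min |x| R)
    (ae_of_all _ fun x ↦ le_min (abs_nonneg x) hR.le) (by fun_prop) (p := 2) two_pos
  simp only [Real.rpow_two] at h
  rw [h]
  -- The layer-cake weight `t` times the tail `t ^ (-p)` is integrable at `0` because `p < 2`.
  have hint : IntegrableOn (fun t : ℝ ↦ 8 * t ^ (1 - p)) (Set.Ioc 0 R) :=
    ((intervalIntegrable_iff_integrableOn_Ioc_of_le hR.le).mp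
      (intervalIntegral.intervalIntegrable_rpow' (by linarith))).const_mul 8
  calc ENNReal.ofReal 2 * ∫⁻ t in Set.Ioi (0 : ℝ),
        μ {x | t < min |x| R} * ENNReal.ofReal (t ^ ((2 : ℝ) - 1))
      ≤ ENNReal.ofReal 2 * ∫⁻ t in Set.Ioi (0 : ℝ),
          (Set.Ioc 0 R).indicator (fun t ↦ ENNReal.ofReal (8 * t ^ (1 - p))) t := by
        gcongr 1
        refine setLIntegral_mono' measurableSet_Ioi fun t ht ↦ ?_
        have ht' : (0 : ℝ) < t := ht
        by_cases htR : t ≤ R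
        · rw [Set.indicator_of_mem (show t ∈ Set.Ioc 0 R from ⟨ht', htR⟩)]
          calc μ {x | t < min |x| R} * ENNReal.ofReal (t ^ ((2 : ℝ) - 1))
              ≤ ENNReal.ofReal (8 * t ^ (-p)) * ENNReal.ofReal (t ^ ((2 : ℝ) - 1)) := by
                gcongr
                refine (measure_mono fun x hx ↦ ?_).trans (stable_measure_tail_le hp hp' hμ ht')
                exact (lt_min_iff.mp (show t < min |x| R from hx)).1
            _ = ENNReal.ofReal (8 * t ^ (1 - p)) := by
                rw [← ENNReal.ofReal_mul (by positivity), mul_assoc, ← Real.rpow_add ht']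
                congr 3
                ring
        · have : {x : ℝ | t < min |x| R} = ∅ := by
            ext x
            simp only [lt_min_iff, Set.mem_ofPred_eq, Set.mem_empty_iff_false, iff_false]
            exact fun h ↦ htR h.2.le
          rw [this]
          simp
    _ = ENNReal.ofReal 2 * ∫⁻ t in Set.Ioc 0 R, ENNReal.ofReal (8 * t ^ (1 - p)) := by
        rw [setLIntegral_indicator measurableSet_Ioc,
          Set.inter_eq_left.mpr Set.Ioc_subset_Ioi_self]
    _ = ENNReal.ofReal 2 * ENNReal.ofReal (∫ t in Set.Ioc 0 R, 8 * t ^ (1 - p)) := by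
        rw [ofReal_integral_eq_lintegral_ofReal hint]
        refine (ae_restrict_iff' measurableSet_Ioc).mpr (ae_of_all _ fun t ht ↦ ?_)
        have ht' : (0 : ℝ) < t := ht.1
        show (0 : ℝ) ≤ 8 * t ^ (1 - p)
        positivity
    _ ≤ ENNReal.ofReal (16 / (2 - p) * R ^ (2 - p)) := by
        rw [← ENNReal.ofReal_mul two_pos.le, ← intervalIntegral.integral_of_le hR.le,
          intervalIntegral.integral_const_mul, integral_rpow (Or.inl (by linarith)),
          show 1 - p + 1 = 2 - p by ring, Real.zero_rpow hp2.ne']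
        exact (congrArg _ (by ring)).le

theorem integral_cos_eq_re_charFun (t : ℝ) :
    ∫ x, Real.cos (t * x) ∂μ = (charFun μ t).re := by
  have hi : Integrable (fun x : ℝ ↦ Complex.exp (t * x * Complex.I)) μ := by
    refine (integrable_const (1 : ℝ)).mono' (by fun_prop) (ae_of_all _ fun x ↦ ?_)
    rw [← Complex.ofReal_mul, Complex.norm_exp_ofReal_mul_I]
  rw [charFun_apply_real]
  have h : (∫ x : ℝ, Complex.exp (t * x * Complex.I) ∂μ).re
      = ∫ x : ℝ, (Complex.exp (t * x * Complex.I)).re ∂μ := (integral_re hi).symm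
  rw [h]
  refine integral_congr_ae (ae_of_all _ fun x ↦ ?_)
  show Real.cos (t * x) = (Complex.exp (t * x * Complex.I)).re
  rw [← Complex.ofReal_mul, Complex.exp_ofReal_mul_I_re]

/-- The deviation of the characteristic function from `1` is controlled by a
truncated second moment and a tail. -/
theorem stable_le_min_sq_add_tail
    (hμ : ∀ t : ℝ, charFun μ t = ((Real.exp (-|t| ^ p) : ℝ) : ℂ)) {u R : ℝ}
    (hu : 0 < u) (hR : 0 < R) :
    1 - Real.exp (-u ^ p) ≤ u ^ 2 / 2 * ∫ x, (min |x| R) ^ 2 ∂μ + 2 * μ.real {x | R < |x|} := by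
  have hm : MeasurableSet {x : ℝ | R < |x|} := measurableSet_lt measurable_const (by fun_prop)
  have hcos : Integrable (fun x : ℝ ↦ Real.cos (u * x)) μ :=
    (integrable_const (1 : ℝ)).mono' (by fun_prop)
      (ae_of_all _ fun x ↦ by simpa using Real.abs_cos_le_one (u * x))
  have hmin : Integrable (fun x : ℝ ↦ (min |x| R) ^ 2) μ := by
    refine (integrable_const (R ^ 2)).mono' (by fun_prop) (ae_of_all _ fun x ↦ ?_)
    have h0 : 0 ≤ min |x| R := le_min (abs_nonneg x) hR.le
    rw [Real.norm_eq_abs, abs_of_nonneg (sq_nonneg _)]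
    exact pow_le_pow_left₀ h0 (min_le_right _ _) 2
  have hind : Integrable ({x : ℝ | R < |x|}.indicator (fun _ ↦ (2 : ℝ))) μ :=
    (integrable_const (2 : ℝ)).indicator hm
  have h1 : 1 - Real.exp (-u ^ p) = ∫ x, (1 - Real.cos (u * x)) ∂μ := by
    rw [integral_sub (integrable_const _) hcos, integral_cos_eq_re_charFun, hμ, abs_of_pos hu,
      Complex.ofReal_re]
    simp
  have h2 : u ^ 2 / 2 * ∫ x, (min |x| R) ^ 2 ∂μ + 2 * μ.real {x | R < |x|}
      = ∫ x, (u ^ 2 / 2 * (min |x| R) ^ 2 + {x : ℝ | R < |x|}.indicator (fun _ ↦ (2 : ℝ)) x) ∂μ := by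
    rw [integral_add (hmin.const_mul _) hind, integral_const_mul, integral_indicator_const _ hm]
    simp [mul_comm]
  rw [h1, h2]
  refine integral_mono ((integrable_const _).sub hcos) ((hmin.const_mul _).add hind) fun x ↦ ?_
  show 1 - Real.cos (u * x)
    ≤ u ^ 2 / 2 * (min |x| R) ^ 2 + {x : ℝ | R < |x|}.indicator (fun _ ↦ (2 : ℝ)) x
  -- Beyond `R` use `1 - cos ≤ 2`; below it use `1 - cos y ≤ y ^ 2 / 2`.
  by_cases hx : R < |x|
  · rw [Set.indicator_of_mem (show x ∈ {x : ℝ | R < |x|} from hx)]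
    have : 0 ≤ u ^ 2 / 2 * (min |x| R) ^ 2 := by positivity
    linarith [Real.neg_one_le_cos (u * x)]
  · rw [Set.indicator_of_notMem (show x ∉ {x : ℝ | R < |x|} from hx), min_eq_left (not_lt.mp hx),
      sq_abs]
    have := Real.one_sub_sq_div_two_le_cos (x := u * x)
    nlinarith

/-- Lower tail bound for standard symmetric `p`-stable laws. -/
theorem exists_stable_tail_ge (hp : 1 < p) (hp' : p < 2) :
    ∃ c : ℝ, 0 < c ∧ ∀ (μ : Measure ℝ) [IsProbabilityMeasure μ],
      (∀ t : ℝ, charFun μ t = ((Real.exp (-|t| ^ p) : ℝ) : ℂ)) →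
      ∀ r : ℝ, 1 ≤ r → c * r ^ (-p) ≤ μ.real {x | r < |x|} := by
  have hp2 : 0 < 2 - p := by linarith
  -- With `u = ε / r` and `w = u ^ p`, this `ε` makes the truncated second moment contribute at most
  -- `w / 4`, half of the lower bound `w / 2` for `1 - charFun μ u`. The tail must supply the rest.
  set ε : ℝ := min 1 (((2 - p) / 32) ^ (1 / (2 - p))) with hε
  have hε0 : 0 < ε := lt_min one_pos (by positivity)
  have hε1 : ε ≤ 1 := min_le_left _ _
  have hεp : ε ^ (2 - p) ≤ (2 - p) / 32 := by
    calc ε ^ (2 - p) ≤ (((2 - p) / 32) ^ (1 / (2 - p))) ^ (2 - p) :=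
          Real.rpow_le_rpow hε0.le (min_le_right _ _) hp2.le
      _ = (2 - p) / 32 := by
          rw [← Real.rpow_mul (by positivity), one_div_mul_cancel hp2.ne', Real.rpow_one]
  refine ⟨ε ^ p / 8, by positivity, fun μ _ hμ r hr ↦ ?_⟩
  have hr0 : 0 < r := by linarith
  set u := ε / r with hu
  have hu0 : 0 < u := by positivity
  have hu1 : u ≤ 1 := (div_le_one hr0).mpr (hε1.trans hr)
  set w := u ^ p with hw
  have hw0 : 0 < w := by positivity
  have hw1 : w ≤ 1 := Real.rpow_le_one hu0.le hu1 (by linarith)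
  have hexp : w / 2 ≤ 1 - Real.exp (-w) := by
    have h1 : Real.exp (-w) ≤ 1 / (1 + w) := by
      rw [Real.exp_neg, ← one_div]
      exact one_div_le_one_div_of_le (by linarith) (by linarith [Real.add_one_le_exp w])
    have h2 : 1 / (1 + w) ≤ 1 - w / 2 := by
      rw [div_le_iff₀ (by linarith)]
      nlinarith
    linarith
  have hmain := stable_le_min_sq_add_tail hμ hu0 hr0
  have hms := stable_integral_min_sq_le hp hp' hμ hr0
  have hsq : u ^ 2 / 2 * ∫ x, (min |x| r) ^ 2 ∂μ ≤ w / 4 := by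
    calc u ^ 2 / 2 * ∫ x, (min |x| r) ^ 2 ∂μ
        ≤ u ^ 2 / 2 * (16 / (2 - p) * r ^ (2 - p)) := by gcongr
      _ = 8 / (2 - p) * (u ^ p * (u ^ (2 - p) * r ^ (2 - p))) := by
          rw [← mul_assoc (u ^ p), ← Real.rpow_add hu0, show p + (2 - p) = (2 : ℝ) by ring,
            Real.rpow_two]
          ring
      _ = 8 / (2 - p) * (w * ε ^ (2 - p)) := by
          rw [← Real.mul_rpow hu0.le hr0.le, hu, div_mul_cancel₀ _ hr0.ne']
      _ ≤ 8 / (2 - p) * (w * ((2 - p) / 32)) := by gcongr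
      _ = w / 4 := by field_simp; norm_num
  have hwr : w = ε ^ p * r ^ (-p) := by
    rw [hw, hu, Real.div_rpow hε0.le hr0.le, Real.rpow_neg hr0.le, div_eq_mul_inv]
  have : w / 8 ≤ μ.real {x | r < |x|} := by linarith
  rw [hwr] at this
  linarith

end StableTails

/-! ### Maxima of finitely many random variables against a threshold. -/

section Maxima

theorem iSup_abs_nonneg {ι : Type*} (z : ι → ℝ) : 0 ≤ ⨆ i, |z i| :=
  Real.iSup_nonneg fun _ ↦ abs_nonneg _

variable {Ω ι : Type*} [MeasurableSpace Ω] [Fintype ι] {P : Measure Ω}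

theorem le_iSup_abs (z : ι → ℝ) (i : ι) : |z i| ≤ ⨆ i, |z i| :=
  le_ciSup (f := fun i ↦ |z i|) (Set.finite_range _).bddAbove i

/-- Only the parts above `T` are summed, so the union bound costs tails and not full moments. The
hypothesis `0 ≤ T` also covers an empty index type, where the real supremum is `0`. -/
theorem iSup_abs_le_add_sum_excess (z : ι → ℝ) {T : ℝ} (hT : 0 ≤ T) :
    ⨆ i, |z i| ≤ T + ∑ i, max (|z i| - T) 0 := by
  have h0 : ∀ i, 0 ≤ max (|z i| - T) 0 := fun i ↦ le_max_right _ _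
  refine Real.iSup_le (fun i ↦ ?_) (add_nonneg hT (Finset.sum_nonneg fun i _ ↦ h0 i))
  have h1 := Finset.single_le_sum (f := fun i ↦ max (|z i| - T) 0) (fun i _ ↦ h0 i)
    (Finset.mem_univ i)
  linarith [le_max_left (|z i| - T) 0]

/-- The version for squares, suited to Gaussian tails. -/
theorem iSup_abs_sq_le_add_sum_excess (z : ι → ℝ) {T : ℝ} (hT : 0 ≤ T) :
    (⨆ i, |z i|) ^ 2 ≤ T + ∑ i, max (z i ^ 2 - T) 0 := by
  have h0 : ∀ i, 0 ≤ max (z i ^ 2 - T) 0 := fun i ↦ le_max_right _ _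
  have hS : 0 ≤ T + ∑ i, max (z i ^ 2 - T) 0 := add_nonneg hT (Finset.sum_nonneg fun i _ ↦ h0 i)
  rw [← Real.le_sqrt (iSup_abs_nonneg z) hS]
  refine Real.iSup_le (fun i ↦ Real.abs_le_sqrt ?_) (Real.sqrt_nonneg _)
  have h1 := Finset.single_le_sum (f := fun i ↦ max (z i ^ 2 - T) 0) (fun i _ ↦ h0 i)
    (Finset.mem_univ i)
  linarith [le_max_left (z i ^ 2 - T) 0]

theorem measurable_iSup_abs {X : ι → Ω → ℝ} (hX : ∀ i, Measurable (X i)) :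
    Measurable fun ω ↦ ⨆ i, |X i ω| :=
  Measurable.iSup fun i ↦ (hX i).abs

theorem integrable_iSup_abs {X : ι → Ω → ℝ} (hX : ∀ i, Measurable (X i))
    (hI : ∀ i, Integrable (X i) P) : Integrable (fun ω ↦ ⨆ i, |X i ω|) P := by
  refine (integrable_finsetSum Finset.univ fun i _ ↦ (hI i).abs).mono'
    (measurable_iSup_abs hX).aestronglyMeasurable (ae_of_all _ fun ω ↦ ?_)
  rw [Real.norm_eq_abs, abs_of_nonneg (iSup_abs_nonneg fun i ↦ X i ω)]
  exact Real.iSup_le (fun i ↦ Finset.single_le_sum (f := fun i ↦ |X i ω|)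
    (fun i _ ↦ abs_nonneg _) (Finset.mem_univ i)) (Finset.sum_nonneg fun i _ ↦ abs_nonneg _)

/-- By independence the probability of no exceedance is `∏ (1 - q i) ≤ exp (-∑ q i)`, where `q i`
are the individual exceedance probabilities. -/
theorem one_sub_exp_neg_le_measureReal_exists [IsProbabilityMeasure P] {X : ι → Ω → ℝ}
    (hX : ∀ i, Measurable (X i)) (hind : iIndepFun X P) {T c : ℝ}
    (hc : c ≤ ∑ i, P.real {ω | T < |X i ω|}) :
    1 - Real.exp (-c) ≤ P.real {ω | ∃ i, T < |X i ω|} := by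
  have hs : MeasurableSet {x : ℝ | |x| ≤ T} := measurableSet_le (by fun_prop) measurable_const
  have hA : ∀ i, MeasurableSet {ω | T < |X i ω|} := fun i ↦
    measurableSet_lt measurable_const (hX i).abs
  have hE : MeasurableSet {ω | ∃ i, T < |X i ω|} := by
    rw [Set.ofPred_exists]
    exact MeasurableSet.iUnion hA
  have hcompl : {ω | ∃ i, T < |X i ω|}ᶜ = ⋂ i ∈ Finset.univ, X i ⁻¹' {x : ℝ | |x| ≤ T} := by
    ext ω
    simp
  have hprod : P.real {ω | ∃ i, T < |X i ω|}ᶜ = ∏ i, (1 - P.real {ω | T < |X i ω|}) := by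
    rw [hcompl, measureReal_def, hind.measure_inter_preimage_eq_mul Finset.univ
      (sets := fun _ ↦ {x : ℝ | |x| ≤ T}) (fun _ _ ↦ hs), ENNReal.toReal_prod]
    refine Finset.prod_congr rfl fun i _ ↦ ?_
    rw [← probReal_compl_eq_one_sub (hA i), measureReal_def]
    congr 2
    ext ω
    simp
  have hle : ∏ i, (1 - P.real {ω | T < |X i ω|}) ≤ Real.exp (-c) := by
    calc ∏ i, (1 - P.real {ω | T < |X i ω|}) ≤ ∏ i, Real.exp (-P.real {ω | T < |X i ω|}) :=
          Finset.prod_le_prod (fun i _ ↦ sub_nonneg.mpr measureReal_le_one)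
            fun i _ ↦ Real.one_sub_le_exp_neg _
      _ = Real.exp (-∑ i, P.real {ω | T < |X i ω|}) := by
          rw [← Real.exp_sum, Finset.sum_neg_distrib]
      _ ≤ Real.exp (-c) := by gcongr
  rw [probReal_compl_eq_one_sub hE] at hprod
  linarith

theorem mul_one_sub_exp_neg_le_integral_iSup_abs [IsProbabilityMeasure P] {X : ι → Ω → ℝ}
    (hX : ∀ i, Measurable (X i)) (hI : ∀ i, Integrable (X i) P) (hind : iIndepFun X P)
    {T c : ℝ} (hT : 0 ≤ T) (hc : c ≤ ∑ i, P.real {ω | T < |X i ω|}) :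
    T * (1 - Real.exp (-c)) ≤ ∫ ω, ⨆ i, |X i ω| ∂P := by
  calc T * (1 - Real.exp (-c)) ≤ T * P.real {ω | ∃ i, T < |X i ω|} := by
        gcongr
        exact one_sub_exp_neg_le_measureReal_exists hX hind hc
    _ ≤ T * P.real {ω | T ≤ ⨆ i, |X i ω|} := by
        refine mul_le_mul_of_nonneg_left (measureReal_mono ?_) hT
        rintro ω ⟨i, hi⟩
        exact hi.le.trans (le_iSup_abs (fun i ↦ X i ω) i)
    _ ≤ ∫ ω, ⨆ i, |X i ω| ∂P :=
        mul_meas_ge_le_integral_of_nonneg (ae_of_all _ fun ω ↦ iSup_abs_nonneg fun i ↦ X i ω)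
          (integrable_iSup_abs hX hI) T

end Maxima

/-! ### Weighted maxima of stable variables and the `ℓ_p` norm. -/

section StableMaxima

variable {Ω ι : Type*} [MeasurableSpace Ω] [Fintype ι] {P : Measure Ω} {p : ℝ}

theorem IsSymmStable.charFun_map_standard {η : Ω → ℝ} (h : IsSymmStable p 1 η P) (t : ℝ) :
    charFun (P.map η) t = ((Real.exp (-|t| ^ p) : ℝ) : ℂ) := by
  simpa only [one_mul] using h.2 t

theorem IsSymmStable.inv_mul {σ : ℝ} (hσ : 0 < σ) {η : Ω → ℝ} (h : IsSymmStable p σ η P) :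
    IsSymmStable p 1 (fun ω ↦ σ⁻¹ * η ω) P := by
  refine ⟨h.1.const_mul _, fun t ↦ ?_⟩
  rw [charFun_map_mul_comp h.1.aemeasurable, h.2, abs_mul, abs_of_pos (inv_pos.mpr hσ),
    mul_inv_cancel_left₀ hσ.ne', one_mul]

variable [IsProbabilityMeasure P]

theorem sum_abs_rpow_eq_rpow (hp : 1 < p) (x : ι → ℝ) :
    ∑ i, |x i| ^ p = ((∑ i, |x i| ^ p) ^ (1 / p)) ^ p := by
  rw [← Real.rpow_mul (by positivity), one_div_mul_cancel (by linarith), Real.rpow_one]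

theorem abs_le_sum_rpow (hp : 1 < p) (x : ι → ℝ) (i : ι) :
    |x i| ≤ (∑ i, |x i| ^ p) ^ (1 / p) := by
  calc |x i| = (|x i| ^ p) ^ (1 / p) := by
        rw [← Real.rpow_mul (abs_nonneg _), mul_one_div_cancel (by linarith), Real.rpow_one]
    _ ≤ (∑ i, |x i| ^ p) ^ (1 / p) := by
        refine Real.rpow_le_rpow (by positivity) ?_ (by positivity)
        exact Finset.single_le_sum (f := fun i ↦ |x i| ^ p) (fun i _ ↦ by positivity)
          (Finset.mem_univ i)

theorem IsSymmStable.integrable (hp : 1 < p) (hp' : p < 2) {η : Ω → ℝ}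
    (h : IsSymmStable p 1 η P) : Integrable η P := by
  have := Measure.isProbabilityMeasure_map (μ := P) h.1.aemeasurable
  exact (integrable_map_measure (by fun_prop) h.1.aemeasurable).mp
    (stable_integrable_id hp hp' h.charFun_map_standard)

theorem IsSymmStable.integral_excess_le (hp : 1 < p) (hp' : p < 2) {η : Ω → ℝ}
    (h : IsSymmStable p 1 η P) {T : ℝ} (hT : 0 < T) (x : ℝ) :
    Integrable (fun ω ↦ max (|x * η ω| - T) 0) P ∧
    ∫ ω, max (|x * η ω| - T) 0 ∂P ≤ 8 / (p - 1) * |x| ^ p * T ^ (1 - p) := by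
  have hP := Measure.isProbabilityMeasure_map (μ := P) h.1.aemeasurable
  rcases eq_or_ne x 0 with rfl | hx
  · have hz : ∀ ω, max (|(0 : ℝ) * η ω| - T) 0 = 0 := fun ω ↦ by simp [hT.le]
    simp only [hz]
    refine ⟨integrable_zero _ _ _, ?_⟩
    have : 0 < p - 1 := by linarith
    simp only [integral_zero]
    positivity
  · have hx0 : 0 < |x| := abs_pos.mpr hx
    have hs : 0 < T / |x| := by positivity
    have he : ∀ ω, max (|x * η ω| - T) 0 = |x| * max (|η ω| - T / |x|) 0 := by
      intro ω
      rw [mul_max_of_nonneg _ _ hx0.le, abs_mul, mul_sub, mul_div_cancel₀ _ hx0.ne', mul_zero]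
    simp only [he]
    have h1 := stable_integrable_excess hp hp' h.charFun_map_standard hs
    have h2 := stable_integral_excess_le hp hp' h.charFun_map_standard hs
    rw [integral_map h.1.aemeasurable (by fun_prop)] at h2
    refine ⟨((integrable_map_measure (by fun_prop) h.1.aemeasurable).mp h1).const_mul _, ?_⟩
    rw [integral_const_mul]
    calc |x| * ∫ ω, max (|η ω| - T / |x|) 0 ∂P
        ≤ |x| * (8 / (p - 1) * (T / |x|) ^ (1 - p)) := by gcongr
      _ = 8 / (p - 1) * |x| ^ p * T ^ (1 - p) := by
          have : |x| ^ p = |x| / |x| ^ (1 - p) := by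
            rw [eq_div_iff (by positivity), ← Real.rpow_add hx0]
            simp
          rw [Real.div_rpow hT.le hx0.le, this]
          ring

/-- Upper bound for the expected maximum of weighted standard stable variables. -/
theorem integral_iSup_stable_le (hp : 1 < p) (hp' : p < 2) {η : ι → Ω → ℝ}
    (hη : ∀ i, IsSymmStable p 1 (η i) P) (x : ι → ℝ) :
    ∫ ω, ⨆ i, |x i * η i ω| ∂P ≤ (1 + 8 / (p - 1)) * (∑ i, |x i| ^ p) ^ (1 / p) := by
  have hp0 : 0 < p - 1 := by linarith
  set N := (∑ i, |x i| ^ p) ^ (1 / p) with hN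
  have hN0 : 0 ≤ N := by positivity
  rcases hN0.eq_or_lt with h0 | hpos
  · have hx : ∀ i, x i = 0 := fun i ↦ by
      have := abs_le_sum_rpow hp x i
      rw [← hN, ← h0] at this
      exact abs_nonpos_iff.mp this
    simp [hx, ← h0]
  · have hex := fun i ↦ (hη i).integral_excess_le hp hp' hpos (x i)
    have hsum : Integrable (fun ω ↦ ∑ i, max (|x i * η i ω| - N) 0) P :=
      integrable_finsetSum _ fun i _ ↦ (hex i).1
    -- At threshold `N` the excesses sum to a multiple of `N ^ p * N ^ (1 - p) = N`, the same order
    -- as the threshold.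
    calc ∫ ω, ⨆ i, |x i * η i ω| ∂P ≤ ∫ ω, (N + ∑ i, max (|x i * η i ω| - N) 0) ∂P := by
          refine integral_mono (integrable_iSup_abs (fun i ↦ (hη i).1.const_mul _)
            fun i ↦ ((hη i).integrable hp hp').const_mul _) ((integrable_const _).add hsum)
            fun ω ↦ iSup_abs_le_add_sum_excess (fun i ↦ x i * η i ω) hN0
      _ = N + ∑ i, ∫ ω, max (|x i * η i ω| - N) 0 ∂P := by
          rw [integral_add (integrable_const _) hsum, integral_finsetSum _ fun i _ ↦ (hex i).1]
          simp
      _ ≤ N + ∑ i, 8 / (p - 1) * |x i| ^ p * N ^ (1 - p) := by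
          gcongr with i
          exact (hex i).2
      _ = N + 8 / (p - 1) * (N ^ p * N ^ (1 - p)) := by
          rw [← Finset.sum_mul, ← Finset.mul_sum, sum_abs_rpow_eq_rpow hp, mul_assoc]
      _ = (1 + 8 / (p - 1)) * N := by
          rw [← Real.rpow_add hpos]
          simp only [add_sub_cancel, Real.rpow_one]
          ring

/-- Lower bound for the expected maximum of weighted standard stable variables. -/
theorem exists_le_integral_iSup_stable (hp : 1 < p) (hp' : p < 2) :
    ∃ c : ℝ, 0 < c ∧ ∀ {Ω ι : Type*} [MeasurableSpace Ω] [Fintype ι] {P : Measure Ω}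
      [IsProbabilityMeasure P] {η : ι → Ω → ℝ}, (∀ i, IsSymmStable p 1 (η i) P) →
      iIndepFun η P → ∀ x : ι → ℝ,
      c * (∑ i, |x i| ^ p) ^ (1 / p) ≤ ∫ ω, ⨆ i, |x i * η i ω| ∂P := by
  obtain ⟨c, hc, htail⟩ := exists_stable_tail_ge hp hp'
  refine ⟨1 - Real.exp (-c), by simpa using hc, fun {Ω ι _ _ P _ η} hη hind x ↦ ?_⟩
  set N := (∑ i, |x i| ^ p) ^ (1 / p) with hN
  have hN0 : 0 ≤ N := by positivity
  rcases hN0.eq_or_lt with h0 | hpos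
  · rw [← h0, mul_zero]
    exact integral_nonneg fun ω ↦ iSup_abs_nonneg fun i ↦ x i * η i ω
  · rw [mul_comm]
    refine mul_one_sub_exp_neg_le_integral_iSup_abs (fun i ↦ (hη i).1.const_mul _)
      (fun i ↦ ((hη i).integrable hp hp').const_mul _)
      (hind.comp (fun i y ↦ x i * y) fun i ↦ by fun_prop) hN0 ?_
    -- At threshold `N` the tail probabilities sum to at least `c`. The tail bound needs `N / |x i|
    -- ≥ 1`, which holds since `N` dominates every coordinate.
    calc c = ∑ i, c * (|x i| ^ p * N ^ (-p)) := by
          rw [← Finset.mul_sum, ← Finset.sum_mul, sum_abs_rpow_eq_rpow hp, ← hN,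
            ← Real.rpow_add hpos]
          simp
      _ ≤ ∑ i, P.real {ω | N < |x i * η i ω|} := by
          refine Finset.sum_le_sum fun i _ ↦ ?_
          rcases eq_or_ne (x i) 0 with hx | hx
          · rw [hx, abs_zero, Real.zero_rpow (by linarith)]
            simp
          · have hx0 : 0 < |x i| := abs_pos.mpr hx
            have := Measure.isProbabilityMeasure_map (μ := P) (hη i).1.aemeasurable
            have h1 := htail (P.map (η i)) (hη i).charFun_map_standard (N / |x i|)
              ((one_le_div hx0).mpr (abs_le_sum_rpow hp x i))
            rw [map_measureReal_apply (hη i).1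
              (measurableSet_lt measurable_const (by fun_prop))] at h1
            calc c * (|x i| ^ p * N ^ (-p)) = c * (N / |x i|) ^ (-p) := by
                  rw [Real.div_rpow hN0 hx0.le, Real.rpow_neg hx0.le, div_inv_eq_mul]
                  ring
              _ ≤ _ := h1
              _ = P.real {ω | N < |x i * η i ω|} := by
                  congr 1
                  ext ω
                  simp [abs_mul, div_lt_iff₀' hx0]

end StableMaxima

/-! ### Gaussian tail and excess estimates. -/

section GaussianLaw

/-- Integrate the density over `(s, s + 1]`, where `x ^ 2 / 2 ≤ (s + 1) ^ 2 / 2 ≤ s ^ 2 + 1`. The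
lossy exponent `s ^ 2` is harmless, since `gaussOrlicz` decays faster still. -/
theorem gaussianReal_tail_ge {s : ℝ} (hs : 0 ≤ s) :
    (√(2 * Real.pi))⁻¹ * Real.exp (-1) * Real.exp (-s ^ 2)
      ≤ (gaussianReal 0 1).real {x | s < |x|} := by
  have hI : IntegrableOn (gaussianPDFReal 0 1) (Set.Ioc s (s + 1)) :=
    (integrable_gaussianPDFReal 0 1).integrableOn
  have h1 : (gaussianReal 0 1).real (Set.Ioc s (s + 1))
      = ∫ x in Set.Ioc s (s + 1), gaussianPDFReal 0 1 x := by
    rw [measureReal_def, gaussianReal_apply_eq_integral _ one_ne_zero, ENNReal.toReal_ofReal]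
    exact integral_nonneg fun x ↦ gaussianPDFReal_nonneg _ _ _
  have h2 : (√(2 * Real.pi))⁻¹ * Real.exp (-1) * Real.exp (-s ^ 2)
      = ∫ x in Set.Ioc s (s + 1), (√(2 * Real.pi))⁻¹ * Real.exp (-1) * Real.exp (-s ^ 2) := by
    simp
  calc _ ≤ (gaussianReal 0 1).real (Set.Ioc s (s + 1)) := by
        rw [h1, h2]
        refine setIntegral_mono_on (integrableOn_const (by simp)) hI measurableSet_Ioc fun x hx ↦ ?_
        rw [mul_assoc, ← Real.exp_add, gaussianPDFReal]
        simp only [NNReal.coe_one, mul_one, sub_zero]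
        gcongr
        have := hx.1
        have := hx.2
        nlinarith [sq_nonneg (s - 1)]
    _ ≤ _ := measureReal_mono fun x hx ↦ lt_of_lt_of_le hx.1 (le_abs_self x)

theorem integrable_exp_sq_div_four_gaussianReal :
    Integrable (fun x : ℝ ↦ Real.exp (x ^ 2 / 4)) (gaussianReal 0 1) := by
  rw [gaussianReal_of_var_ne_zero _ one_ne_zero, gaussianPDF_def,
    integrable_withDensity_iff_integrable_smul' (by fun_prop) (by simp)]
  have h := (integrable_exp_neg_mul_sq (b := 1 / 4) (by norm_num)).const_mul (√(2 * Real.pi))⁻¹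
  refine h.congr (ae_of_all _ fun x ↦ ?_)
  beta_reduce
  rw [ENNReal.toReal_ofReal (gaussianPDFReal_nonneg 0 1 x), smul_eq_mul, gaussianPDFReal]
  simp only [NNReal.coe_one, mul_one, sub_zero]
  rw [mul_assoc, ← Real.exp_add]
  congr 2
  ring

/-- Apply `z ≤ exp z` to `z = x ^ 2 / 4 - 3 / (2 * y ^ 2)`. The threshold `6` produces the exponent
of `gaussOrlicz`, and `exp (x ^ 2 / 4)` is still Gaussian-integrable. -/
theorem gaussianReal_excess_le_exp {y : ℝ} (hy : 0 < y) (x : ℝ) :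
    max ((y * x) ^ 2 - 6) 0
      ≤ 4 * y ^ 2 * Real.exp (-3 / (2 * y ^ 2)) * Real.exp (x ^ 2 / 4) := by
  refine max_le ?_ (by positivity)
  have h := Real.add_one_le_exp (-3 / (2 * y ^ 2) + x ^ 2 / 4)
  rw [Real.exp_add] at h
  have h2 : (y * x) ^ 2 - 6 = 4 * y ^ 2 * (-3 / (2 * y ^ 2) + x ^ 2 / 4) := by
    field_simp
    ring
  rw [h2, mul_assoc (4 * y ^ 2)]
  gcongr
  linarith

end GaussianLaw

/-! ### Elementary estimates for the Orlicz function. -/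

section Orlicz

theorem gaussOrlicz_zero : gaussOrlicz 0 = 0 := by simp [gaussOrlicz]

theorem gaussOrlicz_of_lt_one {s : ℝ} (hs : 0 < s) (hs' : s < 1) :
    gaussOrlicz s = Real.exp (-3 / (2 * s ^ 2)) := by
  simp [gaussOrlicz, hs.ne', hs']

theorem gaussOrlicz_of_one_le {s : ℝ} (hs : 1 ≤ s) :
    gaussOrlicz s = Real.exp (-3 / 2) * (3 * s - 2) := by
  simp [gaussOrlicz, (by linarith : s ≠ 0), not_lt.mpr hs]

theorem gaussOrlicz_nonneg {s : ℝ} (hs : 0 ≤ s) : 0 ≤ gaussOrlicz s := by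
  rcases hs.eq_or_lt with rfl | hs
  · rw [gaussOrlicz_zero]
  rcases lt_or_ge s 1 with h | h
  · rw [gaussOrlicz_of_lt_one hs h]
    positivity
  · rw [gaussOrlicz_of_one_le h]
    exact mul_nonneg (Real.exp_pos _).le (by linarith)

theorem gaussOrlicz_le_self {s : ℝ} (hs : 0 ≤ s) : gaussOrlicz s ≤ s := by
  rcases hs.eq_or_lt with rfl | hs
  · rw [gaussOrlicz_zero]
  rcases lt_or_ge s 1 with h | h
  · rw [gaussOrlicz_of_lt_one hs h, neg_div, Real.exp_neg]
    rw [inv_le_comm₀ (Real.exp_pos _) hs]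
    have h1 := Real.add_one_le_exp (3 / (2 * s ^ 2))
    have h2 : s⁻¹ ≤ 3 / (2 * s ^ 2) := by
      rw [inv_eq_one_div, div_le_div_iff₀ hs (by positivity)]
      nlinarith
    linarith
  · rw [gaussOrlicz_of_one_le h, neg_div, Real.exp_neg, inv_mul_le_iff₀ (Real.exp_pos _)]
    have h1 := Real.quadratic_le_exp_of_nonneg (x := 3 / 2) (by norm_num)
    nlinarith

theorem le_four_of_gaussOrlicz_le_one {s : ℝ} (h : gaussOrlicz s ≤ 1) : s ≤ 4 := by
  by_contra! hs
  rw [gaussOrlicz_of_one_le (by linarith), neg_div, Real.exp_neg,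
    inv_mul_le_iff₀ (Real.exp_pos _), mul_one] at h
  have h1 : Real.exp (3 / 2) ≤ Real.exp 1 * Real.exp 1 := by
    rw [← Real.exp_add]
    exact Real.exp_le_exp.mpr (by norm_num)
  have h2 := Real.exp_one_lt_d9
  have h3 := Real.exp_pos 1
  nlinarith

/-- Converts the factor in the Gaussian excess bound into `gaussOrlicz`. On the linear branch `s ≤
4`, so `s ^ 2 ≤ 16`, while `3 * s - 2 ≥ 1`. -/
theorem exp_le_mul_gaussOrlicz {s : ℝ} (hs : 0 < s) (hs' : gaussOrlicz s ≤ 1) :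
    s ^ 2 * Real.exp (-3 / (2 * s ^ 2)) ≤ 16 * Real.exp (3 / 2) * gaussOrlicz s := by
  rcases lt_or_ge s 1 with h | h
  · rw [gaussOrlicz_of_lt_one hs h]
    have h1 : s ^ 2 ≤ 1 := by nlinarith
    have h2 : 1 ≤ Real.exp (3 / 2) := Real.one_le_exp (by norm_num)
    gcongr
    linarith
  · have h4 := le_four_of_gaussOrlicz_le_one hs'
    rw [gaussOrlicz_of_one_le h, neg_div, neg_div, mul_assoc 16, ← mul_assoc (Real.exp (3 / 2)),
      ← Real.exp_add, add_neg_cancel, Real.exp_zero, one_mul]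
    have h1 : Real.exp (-(3 / (2 * s ^ 2))) ≤ 1 := by
      rw [Real.exp_le_one_iff, neg_nonpos]
      positivity
    calc s ^ 2 * Real.exp (-(3 / (2 * s ^ 2))) ≤ s ^ 2 * 1 := by gcongr
      _ ≤ 16 * (3 * s - 2) := by nlinarith

theorem gaussOrlicz_le_exp_neg_sq {s : ℝ} (hs : 0 < s) (h : s < 1) :
    gaussOrlicz s ≤ Real.exp (-(1 / s) ^ 2) := by
  rw [gaussOrlicz_of_lt_one hs h]
  gcongr
  rw [div_pow, one_pow, neg_div, neg_le_neg_iff, div_le_div_iff₀ (by positivity) (by positivity)]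
  nlinarith [sq_nonneg s]

variable {n : ℕ}

theorem orliczNorm_nonneg (M : ℝ → ℝ) (x : Fin n → ℝ) : 0 ≤ orliczNorm M x :=
  Real.sInf_nonneg fun _ ht ↦ ht.1.le

/-- Ensures that `orliczNorm` is a genuine infimum and not the default value of `sInf ∅`. -/
theorem gaussOrlicz_levels_nonempty (x : Fin n → ℝ) :
    {t : ℝ | 0 < t ∧ ∑ i, gaussOrlicz (|x i| / t) ≤ 1}.Nonempty := by
  have h0 : 0 ≤ ∑ i, |x i| := Finset.sum_nonneg fun i _ ↦ abs_nonneg _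
  have hpos : 0 < 1 + ∑ i, |x i| := by linarith
  refine ⟨1 + ∑ i, |x i|, hpos, ?_⟩
  calc ∑ i, gaussOrlicz (|x i| / (1 + ∑ i, |x i|)) ≤ ∑ i, |x i| / (1 + ∑ i, |x i|) :=
        Finset.sum_le_sum fun i _ ↦ gaussOrlicz_le_self (by positivity)
    _ ≤ 1 := by
        rw [← Finset.sum_div, div_le_one hpos]
        linarith

end Orlicz

/-! ### Weighted Gaussian maxima and the Orlicz norm. -/

section GaussianMaxima

variable {Ω : Type*} [MeasurableSpace Ω] {P : Measure Ω} {n : ℕ}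

theorem integrable_of_map_eq_gaussianReal {ξ : Ω → ℝ} (hm : Measurable ξ)
    (hξ : P.map ξ = gaussianReal 0 1) : Integrable ξ P := by
  have h := (memLp_id_gaussianReal (μ := 0) (v := 1) 1).integrable le_rfl
  rw [← hξ] at h
  exact (integrable_map_measure (by fun_prop) hm.aemeasurable).mp h

variable [IsProbabilityMeasure P]

theorem integral_excess_gaussian_le {ξ : Ω → ℝ} (hm : Measurable ξ)
    (hξ : P.map ξ = gaussianReal 0 1) {y : ℝ} (hy : 0 ≤ y) (hy' : gaussOrlicz y ≤ 1) :
    Integrable (fun ω ↦ max ((y * ξ ω) ^ 2 - 6) 0) P ∧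
    ∫ ω, max ((y * ξ ω) ^ 2 - 6) 0 ∂P
      ≤ 64 * Real.exp (3 / 2) * (∫ x, Real.exp (x ^ 2 / 4) ∂(gaussianReal 0 1))
        * gaussOrlicz y := by
  rcases hy.eq_or_lt with rfl | hy
  · have hz : ∀ ω, max ((0 * ξ ω) ^ 2 - 6) 0 = 0 := fun ω ↦ by norm_num
    simp only [hz, gaussOrlicz_zero]
    simp
  · have hE : Integrable (fun ω ↦ 4 * y ^ 2 * Real.exp (-3 / (2 * y ^ 2)) *
        Real.exp (ξ ω ^ 2 / 4)) P := by
      have h := integrable_exp_sq_div_four_gaussianReal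
      rw [← hξ] at h
      exact ((integrable_map_measure (by fun_prop) hm.aemeasurable).mp h).const_mul _
    have hI : Integrable (fun ω ↦ max ((y * ξ ω) ^ 2 - 6) 0) P := by
      refine hE.mono' (by fun_prop) (ae_of_all _ fun ω ↦ ?_)
      rw [Real.norm_eq_abs, abs_of_nonneg (le_max_right _ _)]
      exact gaussianReal_excess_le_exp hy _
    refine ⟨hI, ?_⟩
    have hK : 0 ≤ ∫ x, Real.exp (x ^ 2 / 4) ∂(gaussianReal 0 1) :=
      integral_nonneg fun x ↦ (Real.exp_pos _).le
    calc ∫ ω, max ((y * ξ ω) ^ 2 - 6) 0 ∂P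
        ≤ ∫ ω, 4 * y ^ 2 * Real.exp (-3 / (2 * y ^ 2)) * Real.exp (ξ ω ^ 2 / 4) ∂P :=
          integral_mono hI hE fun ω ↦ gaussianReal_excess_le_exp hy _
      _ = 4 * (y ^ 2 * Real.exp (-3 / (2 * y ^ 2)))
          * ∫ x, Real.exp (x ^ 2 / 4) ∂(gaussianReal 0 1) := by
          rw [integral_const_mul, ← hξ, integral_map hm.aemeasurable (by fun_prop), mul_assoc 4]
      _ ≤ 4 * (16 * Real.exp (3 / 2) * gaussOrlicz y)
          * ∫ x, Real.exp (x ^ 2 / 4) ∂(gaussianReal 0 1) := by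
          gcongr 4 * ?_ * _
          exact exp_le_mul_gaussOrlicz hy hy'
      _ = _ := by ring

theorem rpow_le_one_add_sq {p s : ℝ} (hp : 1 < p) (hp' : p < 2) (hs : 0 ≤ s) :
    s ^ p ≤ 1 + s ^ 2 := by
  rcases le_total s 1 with h | h
  · linarith [Real.rpow_le_one hs h (by linarith : 0 ≤ p), sq_nonneg s]
  · have := Real.rpow_le_rpow_of_exponent_le h hp'.le
    rw [Real.rpow_two] at this
    linarith

theorem integral_iSup_gaussian_rpow_le_of_sum_le_one {p : ℝ} (hp : 1 < p) (hp' : p < 2)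
    {ξ : Fin n → Ω → ℝ} (hm : ∀ i, Measurable (ξ i)) (hξ : ∀ i, P.map (ξ i) = gaussianReal 0 1)
    {y : Fin n → ℝ} (hy : ∀ i, 0 ≤ y i) (hsum : ∑ i, gaussOrlicz (y i) ≤ 1) :
    Integrable (fun ω ↦ (⨆ i, |y i * ξ i ω|) ^ p) P ∧
    ∫ ω, (⨆ i, |y i * ξ i ω|) ^ p ∂P
      ≤ 7 + 64 * Real.exp (3 / 2) * ∫ x, Real.exp (x ^ 2 / 4) ∂(gaussianReal 0 1) := by
  set K := 64 * Real.exp (3 / 2) * ∫ x, Real.exp (x ^ 2 / 4) ∂(gaussianReal 0 1) with hK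
  have hK0 : 0 ≤ K := mul_nonneg (by positivity) (integral_nonneg fun x ↦ (Real.exp_pos _).le)
  have hex := fun i ↦ integral_excess_gaussian_le (hm i) (hξ i) (hy i)
    ((Finset.single_le_sum (f := fun i ↦ gaussOrlicz (y i))
      (fun i _ ↦ gaussOrlicz_nonneg (hy i)) (Finset.mem_univ i)).trans hsum)
  have hS : Integrable (fun ω ↦ ∑ i, max ((y i * ξ i ω) ^ 2 - 6) 0) P :=
    integrable_finsetSum _ fun i _ ↦ (hex i).1
  have hB : Integrable (fun ω ↦ 7 + ∑ i, max ((y i * ξ i ω) ^ 2 - 6) 0) P :=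
    (integrable_const _).add hS
  have hle : ∀ ω, (⨆ i, |y i * ξ i ω|) ^ p ≤ 7 + ∑ i, max ((y i * ξ i ω) ^ 2 - 6) 0 := by
    -- The constant `7` is `1` from `s ^ p ≤ 1 + s ^ 2` plus the threshold `6`.
    intro ω
    have h1 := rpow_le_one_add_sq hp hp' (iSup_abs_nonneg fun i ↦ y i * ξ i ω)
    have h2 := iSup_abs_sq_le_add_sum_excess (fun i ↦ y i * ξ i ω) (T := 6) (by norm_num)
    linarith
  have h0 : ∀ ω, 0 ≤ (⨆ i, |y i * ξ i ω|) ^ p := fun ω ↦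
    Real.rpow_nonneg (iSup_abs_nonneg fun i ↦ y i * ξ i ω) p
  have hI : Integrable (fun ω ↦ (⨆ i, |y i * ξ i ω|) ^ p) P := by
    refine hB.mono' ((measurable_iSup_abs fun i ↦ (hm i).const_mul _).pow_const
      p).aestronglyMeasurable (ae_of_all _ fun ω ↦ ?_)
    rw [Real.norm_eq_abs, abs_of_nonneg (h0 ω)]
    exact hle ω
  refine ⟨hI, ?_⟩
  calc ∫ ω, (⨆ i, |y i * ξ i ω|) ^ p ∂P
      ≤ ∫ ω, (7 + ∑ i, max ((y i * ξ i ω) ^ 2 - 6) 0) ∂P := integral_mono hI hB hle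
    _ = 7 + ∑ i, ∫ ω, max ((y i * ξ i ω) ^ 2 - 6) 0 ∂P := by
        rw [integral_add (integrable_const _) hS, integral_finsetSum _ fun i _ ↦ (hex i).1]
        simp
    _ ≤ 7 + ∑ i, K * gaussOrlicz (y i) := by
        gcongr with i
        exact (hex i).2
    _ ≤ 7 + K := by
        rw [← Finset.mul_sum]
        nlinarith

/-- The `p`-th moment of a Gaussian maximum is bounded by the Orlicz norm of the weights. -/
theorem integral_iSup_gaussian_rpow_le {p : ℝ} (hp : 1 < p) (hp' : p < 2)
    {ξ : Fin n → Ω → ℝ} (hm : ∀ i, Measurable (ξ i)) (hξ : ∀ i, P.map (ξ i) = gaussianReal 0 1)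
    (x : Fin n → ℝ) :
    Integrable (fun ω ↦ (⨆ i, |x i * ξ i ω|) ^ p) P ∧
    ∫ ω, (⨆ i, |x i * ξ i ω|) ^ p ∂P
      ≤ (7 + 64 * Real.exp (3 / 2) * ∫ x, Real.exp (x ^ 2 / 4) ∂(gaussianReal 0 1))
        * orliczNorm gaussOrlicz x ^ p := by
  set C := 7 + 64 * Real.exp (3 / 2) * ∫ x, Real.exp (x ^ 2 / 4) ∂(gaussianReal 0 1)
  have hC : 0 < C := add_pos_of_pos_of_nonneg (by norm_num)
    (mul_nonneg (by positivity) (integral_nonneg fun x ↦ (Real.exp_pos _).le))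
  have hp0 : 0 < p := by linarith
  set I := ∫ ω, (⨆ i, |x i * ξ i ω|) ^ p ∂P with hIdef
  have hI0 : 0 ≤ I := integral_nonneg fun ω ↦
    Real.rpow_nonneg (iSup_abs_nonneg fun i ↦ x i * ξ i ω) p
  have hkey : ∀ t ∈ {t : ℝ | 0 < t ∧ ∑ i, gaussOrlicz (|x i| / t) ≤ 1},
      Integrable (fun ω ↦ (⨆ i, |x i * ξ i ω|) ^ p) P ∧ I ≤ C * t ^ p := by
    rintro t ⟨ht, hsum⟩
    obtain ⟨h1, h2⟩ := integral_iSup_gaussian_rpow_le_of_sum_le_one hp hp' hm hξ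
      (y := fun i ↦ |x i| / t) (fun i ↦ by positivity) hsum
    have he : ∀ ω, (⨆ i, |x i * ξ i ω|) ^ p = t ^ p * (⨆ i, |(|x i| / t) * ξ i ω|) ^ p := by
      intro ω
      rw [← Real.mul_rpow ht.le (iSup_abs_nonneg fun i ↦ |x i| / t * ξ i ω),
        Real.mul_iSup_of_nonneg ht.le]
      congr 2
      ext i
      rw [abs_mul, abs_mul, abs_div, abs_abs, abs_of_pos ht]
      field_simp
    rw [hIdef]
    simp only [he]
    refine ⟨h1.const_mul _, ?_⟩
    rw [integral_const_mul, mul_comm]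
    gcongr
  refine ⟨(hkey _ (gaussOrlicz_levels_nonempty x).some_mem).1, ?_⟩
  -- The bound holds at every admissible level `t`, so it passes to the infimum; the infimum need
  -- not be attained, and may be `0`.
  have hle : (I / C) ^ (1 / p) ≤ orliczNorm gaussOrlicz x := by
    refine le_csInf (gaussOrlicz_levels_nonempty x) fun t ht ↦ ?_
    rw [one_div, Real.rpow_inv_le_iff_of_pos (by positivity) ht.1.le hp0, div_le_iff₀' hC]
    exact (hkey t ht).2
  rwa [one_div, Real.rpow_inv_le_iff_of_pos (by positivity) (orliczNorm_nonneg _ _) hp0,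
    div_le_iff₀' hC] at hle

theorem integral_abs_gaussianReal_pos : 0 < ∫ x, |x| ∂(gaussianReal 0 1) := by
  have hI : Integrable (fun x : ℝ ↦ |x|) (gaussianReal 0 1) :=
    ((memLp_id_gaussianReal (μ := 0) (v := 1) 1).integrable le_rfl).abs
  have h1 := mul_meas_ge_le_integral_of_nonneg (ae_of_all _ fun x : ℝ ↦ abs_nonneg x) hI 1
  have h2 := gaussianReal_tail_ge (s := 1) zero_le_one
  have h3 : (gaussianReal 0 1).real {x | 1 < |x|} ≤ (gaussianReal 0 1).real {x | 1 ≤ |x|} :=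
    measureReal_mono fun x (hx : 1 < |x|) ↦ hx.le
  have h4 : 0 < (√(2 * Real.pi))⁻¹ * Real.exp (-1) * Real.exp (-1 ^ 2) := by positivity
  linarith

/-- The expected Gaussian maximum dominates the Orlicz norm of the weights. -/
theorem exists_le_integral_iSup_gaussian :
    ∃ c : ℝ, 0 < c ∧ ∀ {Ω : Type*} [MeasurableSpace Ω] {P : Measure Ω} [IsProbabilityMeasure P]
      {n : ℕ} {ξ : Fin n → Ω → ℝ}, (∀ i, Measurable (ξ i)) →
      (∀ i, P.map (ξ i) = gaussianReal 0 1) → iIndepFun ξ P → ∀ x : Fin n → ℝ,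
      c * orliczNorm gaussOrlicz x ≤ ∫ ω, ⨆ i, |x i * ξ i ω| ∂P := by
  set d : ℝ := (√(2 * Real.pi))⁻¹ * Real.exp (-1) with hd
  have hd0 : 0 < d := by positivity
  set c : ℝ := min (∫ x, |x| ∂(gaussianReal 0 1)) (1 - Real.exp (-d)) with hc
  have hc0 : 0 < c := lt_min integral_abs_gaussianReal_pos (by simpa using hd0)
  refine ⟨c, hc0, fun {Ω _ P _ n ξ} hm hξ hind x ↦ ?_⟩
  have hXm : ∀ i, Measurable fun ω ↦ x i * ξ i ω := fun i ↦ (hm i).const_mul _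
  have hXI : ∀ i, Integrable (fun ω ↦ x i * ξ i ω) P := fun i ↦
    (integrable_of_map_eq_gaussianReal (hm i) (hξ i)).const_mul _
  set I := ∫ ω, ⨆ i, |x i * ξ i ω| ∂P with hI
  have hI0 : 0 ≤ I := integral_nonneg fun ω ↦ iSup_abs_nonneg fun i ↦ x i * ξ i ω
  have hkey : ∀ t : ℝ, 0 < t → 1 < ∑ i, gaussOrlicz (|x i| / t) → c * t ≤ I := by
    intro t ht hsum
    -- A single weight `|x i| ≥ t` already suffices through `E |x i * ξ i|`. Otherwise all ratios
    -- lie below `1`, on the exponential branch, where `gaussOrlicz` is dominated by Gaussian tails.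
    by_cases hbig : ∃ i, t ≤ |x i|
    · obtain ⟨i, hi⟩ := hbig
      calc c * t ≤ (∫ x, |x| ∂(gaussianReal 0 1)) * |x i| := by
            gcongr
            exact min_le_left _ _
        _ = ∫ ω, |x i * ξ i ω| ∂P := by
            simp only [abs_mul]
            rw [integral_const_mul, ← hξ i, integral_map (hm i).aemeasurable (by fun_prop),
              mul_comm]
        _ ≤ I := integral_mono (hXI i).abs (integrable_iSup_abs hXm hXI)
            fun ω ↦ le_iSup_abs (fun i ↦ x i * ξ i ω) i
    · push Not at hbig
      calc c * t ≤ (1 - Real.exp (-d)) * t := by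
            gcongr
            exact min_le_right _ _
        _ = t * (1 - Real.exp (-d)) := mul_comm _ _
        _ ≤ I := by
            refine mul_one_sub_exp_neg_le_integral_iSup_abs hXm hXI
              (hind.comp (fun i y ↦ x i * y) fun i ↦ by fun_prop) ht.le ?_
            calc d ≤ ∑ i, d * gaussOrlicz (|x i| / t) := by
                  rw [← Finset.mul_sum]
                  nlinarith
              _ ≤ ∑ i, P.real {ω | t < |x i * ξ i ω|} := by
                  refine Finset.sum_le_sum fun i _ ↦ ?_
                  rcases eq_or_ne (x i) 0 with hx | hx
                  · rw [hx, abs_zero, zero_div, gaussOrlicz_zero, mul_zero]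
                    positivity
                  · have hx0 : 0 < |x i| := abs_pos.mpr hx
                    have h1 := gaussOrlicz_le_exp_neg_sq (s := |x i| / t) (by positivity)
                      ((div_lt_one ht).mpr (hbig i))
                    have h2 := gaussianReal_tail_ge (s := 1 / (|x i| / t)) (by positivity)
                    rw [← hξ i, map_measureReal_apply (hm i)
                      (measurableSet_lt measurable_const (by fun_prop))] at h2
                    calc d * gaussOrlicz (|x i| / t)
                        ≤ d * Real.exp (-(1 / (|x i| / t)) ^ 2) := by gcongr
                      _ ≤ _ := h2
                      _ = P.real {ω | t < |x i * ξ i ω|} := by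
                          congr 1
                          ext ω
                          simp [abs_mul, div_lt_iff₀' hx0]
  rw [← le_div_iff₀' hc0]
  -- Every `t > I / c` is admissible for the infimum, since otherwise `hkey` would give `c * t ≤ I`.
  refine le_of_forall_gt_imp_ge_of_dense fun t ht ↦ ?_
  have ht0 : 0 < t := (div_nonneg hI0 hc0.le).trans_lt ht
  refine csInf_le ⟨0, fun _ h ↦ h.1.le⟩ ⟨ht0, ?_⟩
  by_contra! hsum
  have := hkey t ht0 hsum
  rw [div_lt_iff₀' hc0] at ht
  linarith

end GaussianMaxima

/-! ### Reduction to the `ℓ_p` norm of a random vector. -/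

section Combination

variable {Ω₁ Ω₂ : Type*} {n m : ℕ}

theorem norm_toLp_eq_sum {p : ℝ} (hp : 1 < p) (v : Fin m → ℝ) :
    ‖WithLp.toLp (ENNReal.ofReal p) v‖ = (∑ j, |v j| ^ p) ^ (1 / p) := by
  have h : (ENNReal.ofReal p).toReal = p := ENNReal.toReal_ofReal (by linarith)
  rw [PiLp.norm_eq_sum (by rw [h]; linarith), h]
  simp only [Real.norm_eq_abs]

/-- The factor `|η j ω₂|` is nonnegative and independent of `i`, so it leaves the inner supremum. -/
theorem maxProd_eq_iSup (a : Matrix (Fin n) (Fin m) ℝ) (ξ : Fin n → Ω₁ → ℝ) (η : Fin m → Ω₂ → ℝ)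
    (ω₁ : Ω₁) (ω₂ : Ω₂) :
    maxProd a ξ η ω₁ ω₂ = ⨆ j, |(⨆ i, |a i j * ξ i ω₁|) * η j ω₂| := by
  have hG : ∀ j, 0 ≤ ⨆ i, |a i j * ξ i ω₁| := fun j ↦ iSup_abs_nonneg fun i ↦ a i j * ξ i ω₁
  refine le_antisymm (Real.iSup_le (fun ij ↦ ?_) (iSup_abs_nonneg _))
    (Real.iSup_le (fun j ↦ ?_) (iSup_abs_nonneg _))
  · calc |a ij.1 ij.2 * η ij.2 ω₂ * ξ ij.1 ω₁| = |a ij.1 ij.2 * ξ ij.1 ω₁| * |η ij.2 ω₂| := by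
          rw [← abs_mul]
          ring_nf
      _ ≤ (⨆ i, |a i ij.2 * ξ i ω₁|) * |η ij.2 ω₂| := by
          gcongr
          exact le_iSup_abs (fun i ↦ a i ij.2 * ξ i ω₁) ij.1
      _ = |(⨆ i, |a i ij.2 * ξ i ω₁|) * η ij.2 ω₂| := by rw [abs_mul, abs_of_nonneg (hG _)]
      _ ≤ _ := le_iSup_abs (fun j ↦ (⨆ i, |a i j * ξ i ω₁|) * η j ω₂) ij.2
  · rw [abs_mul, abs_of_nonneg (hG j), Real.iSup_mul_of_nonneg (abs_nonneg _)]
    refine Real.iSup_le (fun i ↦ ?_) (iSup_abs_nonneg _)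
    rw [← abs_mul, mul_right_comm]
    exact le_iSup_abs (fun ij : Fin n × Fin m ↦ a ij.1 ij.2 * η ij.2 ω₂ * ξ ij.1 ω₁) (i, j)

theorem maxProd_eq_mul_iSup_inv_mul {σ : ℝ} (hσ : 0 < σ) (a : Matrix (Fin n) (Fin m) ℝ)
    (ξ : Fin n → Ω₁ → ℝ) (η : Fin m → Ω₂ → ℝ) (ω₁ : Ω₁) (ω₂ : Ω₂) :
    maxProd a ξ η ω₁ ω₂ = σ * ⨆ j, |(⨆ i, |a i j * ξ i ω₁|) * (σ⁻¹ * η j ω₂)| := by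
  rw [maxProd_eq_iSup, Real.mul_iSup_of_nonneg hσ.le]
  congr 1
  ext j
  rw [← abs_of_pos hσ, ← abs_mul, abs_of_pos hσ]
  congr 1
  field_simp

variable [MeasurableSpace Ω₁] [MeasurableSpace Ω₂] {P₁ : Measure Ω₁} {P₂ : Measure Ω₂}

theorem integrable_maxProd {ξ : Fin n → Ω₁ → ℝ} {η : Fin m → Ω₂ → ℝ}
    (hξ : ∀ i, Measurable (ξ i)) (hξI : ∀ i, Integrable (ξ i) P₁)
    (hη : ∀ j, Measurable (η j)) (hηI : ∀ j, Integrable (η j) P₂)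
    (a : Matrix (Fin n) (Fin m) ℝ) :
    Integrable (fun ω : Ω₁ × Ω₂ ↦ maxProd a ξ η ω.1 ω.2) (P₁.prod P₂) := by
  refine integrable_iSup_abs
    (X := fun (ij : Fin n × Fin m) (ω : Ω₁ × Ω₂) ↦ a ij.1 ij.2 * η ij.2 ω.2 * ξ ij.1 ω.1)
    (fun ij ↦ ?_) fun ij ↦ ?_
  · exact (((hη _).comp measurable_snd).const_mul _).mul ((hξ _).comp measurable_fst)
  · refine (((hξI ij.1).mul_prod (hηI ij.2)).const_mul (a ij.1 ij.2)).congr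
      (ae_of_all _ fun ω ↦ ?_)
    show a ij.1 ij.2 * (ξ ij.1 ω.1 * η ij.2 ω.2) = a ij.1 ij.2 * η ij.2 ω.2 * ξ ij.1 ω.1
    ring

theorem integrable_norm_toLp {p : ℝ} (hp : 1 < p) {G : Fin m → Ω₁ → ℝ}
    (hG : ∀ j, Integrable (G j) P₁) :
    Integrable (fun ω ↦ ‖WithLp.toLp (ENNReal.ofReal p) fun j ↦ G j ω‖) P₁ := by
  have : Fact (1 ≤ ENNReal.ofReal p) := ⟨by simpa using hp.le⟩
  exact (Integrable.of_eval_piLp (f := fun ω ↦ WithLp.toLp (ENNReal.ofReal p) fun j ↦ G j ω)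
    hG).norm

/-- The triangle inequality for Bochner integrals in `PiLp`, a normed space because `1 ≤ p`; the
integral is computed coordinatewise. -/
theorem norm_toLp_integral_le {p : ℝ} (hp : 1 < p) {G : Fin m → Ω₁ → ℝ}
    (hG : ∀ j, Integrable (G j) P₁) :
    ‖WithLp.toLp (ENNReal.ofReal p) fun j ↦ ∫ ω, G j ω ∂P₁‖
      ≤ ∫ ω, ‖WithLp.toLp (ENNReal.ofReal p) fun j ↦ G j ω‖ ∂P₁ := by
  have : Fact (1 ≤ ENNReal.ofReal p) := ⟨by simpa using hp.le⟩
  have h : ∫ ω, (WithLp.toLp (ENNReal.ofReal p) fun j ↦ G j ω) ∂P₁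
      = WithLp.toLp (ENNReal.ofReal p) fun j ↦ ∫ ω, G j ω ∂P₁ := by
    ext j
    exact eval_integral_piLp (f := fun ω ↦ WithLp.toLp (ENNReal.ofReal p) fun j ↦ G j ω) hG j
  rw [← h]
  exact norm_integral_le_integral_norm _

theorem norm_toLp_le_mul {p : ℝ} (hp : 1 < p) {u v : Fin m → ℝ} {c : ℝ} (hc : 0 ≤ c)
    (h : ∀ j, c * |u j| ≤ |v j|) :
    c * ‖WithLp.toLp (ENNReal.ofReal p) u‖ ≤ ‖WithLp.toLp (ENNReal.ofReal p) v‖ := by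
  have hp0 : 0 < p := by linarith
  rw [norm_toLp_eq_sum hp, norm_toLp_eq_sum hp]
  calc c * (∑ j, |u j| ^ p) ^ (1 / p) = (∑ j, (c * |u j|) ^ p) ^ (1 / p) := by
        simp only [Real.mul_rpow hc (abs_nonneg _)]
        rw [← Finset.mul_sum, Real.mul_rpow (by positivity) (by positivity),
          ← Real.rpow_mul hc, mul_one_div_cancel hp0.ne', Real.rpow_one]
    _ ≤ (∑ j, |v j| ^ p) ^ (1 / p) := by
        gcongr with j
        exact h j

/-- The Jensen inequality for the `ℓ_p` norm of a random vector. -/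
theorem integral_norm_toLp_le [IsProbabilityMeasure P₁] {p : ℝ} (hp : 1 < p) {G : Fin m → Ω₁ → ℝ}
    (hG : ∀ j, Integrable (G j) P₁) (hGp : ∀ j, Integrable (fun ω ↦ |G j ω| ^ p) P₁)
    {K : ℝ} (hK : 0 ≤ K) {b : Fin m → ℝ} (hb : ∀ j, ∫ ω, |G j ω| ^ p ∂P₁ ≤ K * |b j| ^ p) :
    ∫ ω, ‖WithLp.toLp (ENNReal.ofReal p) fun j ↦ G j ω‖ ∂P₁
      ≤ K ^ (1 / p) * ‖WithLp.toLp (ENNReal.ofReal p) b‖ := by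
  have hp0 : 0 < p := by linarith
  have hN : ∀ ω, ‖WithLp.toLp (ENNReal.ofReal p) fun j ↦ G j ω‖ ^ p = ∑ j, |G j ω| ^ p := by
    intro ω
    rw [norm_toLp_eq_sum hp]
    exact (sum_abs_rpow_eq_rpow hp fun j ↦ G j ω).symm
  have h0 : ∀ ω, 0 ≤ ‖WithLp.toLp (ENNReal.ofReal p) fun j ↦ G j ω‖ := by
    intro ω
    rw [norm_toLp_eq_sum hp]
    positivity
  have hJ : (∫ ω, ‖WithLp.toLp (ENNReal.ofReal p) fun j ↦ G j ω‖ ∂P₁) ^ p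
      ≤ ∫ ω, ‖WithLp.toLp (ENNReal.ofReal p) fun j ↦ G j ω‖ ^ p ∂P₁ := by
    refine (convexOn_rpow hp.le).map_integral_le (g := fun x ↦ x ^ p)
      (Real.continuous_rpow_const hp0.le).continuousOn isClosed_Ici (ae_of_all _ h0)
      (integrable_norm_toLp hp hG) ?_
    simp only [Function.comp_def, hN]
    exact integrable_finsetSum _ fun j _ ↦ hGp j
  simp only [hN] at hJ
  rw [integral_finsetSum _ fun j _ ↦ hGp j] at hJ
  rw [norm_toLp_eq_sum hp, ← Real.mul_rpow hK (by positivity), one_div,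
    Real.le_rpow_inv_iff_of_pos (integral_nonneg h0) (by positivity) hp0, Finset.mul_sum]
  exact hJ.trans (Finset.sum_le_sum fun j _ ↦ hb j)

end Combination

end StableGauss

open StableGauss

theorem mainTheorem2 (p : ℝ) (hp : 1 < p) (hp' : p < 2) :
    ∃ c C : ℝ, 0 < c ∧ 0 < C ∧
      ∀ (Ω₁ Ω₂ : Type*) [MeasurableSpace Ω₁] [MeasurableSpace Ω₂]
        (P₁ : Measure Ω₁) (P₂ : Measure Ω₂) [IsProbabilityMeasure P₁] [IsProbabilityMeasure P₂]
        (n m : ℕ) (ξ : Fin n → Ω₁ → ℝ) (η : Fin m → Ω₂ → ℝ) (σ : ℝ),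
        0 < σ →
        (∀ i, Measurable (ξ i)) → (∀ i, HasLaw (ξ i) (gaussianReal 0 1) P₁) → iIndepFun ξ P₁ →
        (∀ j, StableGauss.IsSymmStable p σ (η j) P₂) → iIndepFun η P₂ →
        ∀ a : Matrix (Fin n) (Fin m) ℝ,
          Integrable (fun ω : Ω₁ × Ω₂ => StableGauss.maxProd a ξ η ω.1 ω.2) (P₁.prod P₂) ∧
          c * σ * ‖WithLp.toLp (ENNReal.ofReal p)
              (fun j => StableGauss.orliczNorm StableGauss.gaussOrlicz (fun i => a i j))‖
            ≤ ∫ ω₁, ∫ ω₂, StableGauss.maxProd a ξ η ω₁ ω₂ ∂P₂ ∂P₁ ∧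
          ∫ ω₁, ∫ ω₂, StableGauss.maxProd a ξ η ω₁ ω₂ ∂P₂ ∂P₁
            ≤ C * σ * ‖WithLp.toLp (ENNReal.ofReal p)
              (fun j => StableGauss.orliczNorm StableGauss.gaussOrlicz (fun i => a i j))‖ := by
  obtain ⟨c₁, hc₁, hgauss⟩ := exists_le_integral_iSup_gaussian
  obtain ⟨c₂, hc₂, hstable⟩ := exists_le_integral_iSup_stable hp hp'
  set K : ℝ := 7 + 64 * Real.exp (3 / 2) * ∫ x, Real.exp (x ^ 2 / 4) ∂(gaussianReal 0 1) with hKdef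
  have hK : 0 < K := add_pos_of_pos_of_nonneg (by norm_num)
    (mul_nonneg (by positivity) (integral_nonneg fun x ↦ (Real.exp_pos _).le))
  have hp1 : 0 < p - 1 := by linarith
  refine ⟨c₂ * c₁, (1 + 8 / (p - 1)) * K ^ (1 / p), by positivity, by positivity, ?_⟩
  intro Ω₁ Ω₂ _ _ P₁ P₂ _ _ n m ξ η σ hσ hξm hξ hξind hη hηind a
  have hlaw : ∀ i, P₁.map (ξ i) = gaussianReal 0 1 := fun i ↦ (hξ i).map_eq
  have hη' : ∀ j, IsSymmStable p 1 (fun ω ↦ σ⁻¹ * η j ω) P₂ := fun j ↦ (hη j).inv_mul hσ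
  have hηind' : iIndepFun (fun j ω ↦ σ⁻¹ * η j ω) P₂ :=
    hηind.comp (fun _ y ↦ σ⁻¹ * y) fun _ ↦ by fun_prop
  have hξI : ∀ i, Integrable (ξ i) P₁ := fun i ↦
    integrable_of_map_eq_gaussianReal (hξm i) (hlaw i)
  have hηI : ∀ j, Integrable (η j) P₂ := fun j ↦ by
    simpa [mul_inv_cancel_left₀ hσ.ne'] using ((hη' j).integrable hp hp').const_mul σ
  have hint := integrable_maxProd hξm hξI (fun j ↦ (hη j).1) hηI a
  set b : Fin m → ℝ := fun j ↦ orliczNorm gaussOrlicz fun i ↦ a i j with hb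
  have hb0 : ∀ j, 0 ≤ b j := fun j ↦ orliczNorm_nonneg _ _
  set G : Fin m → Ω₁ → ℝ := fun j ω ↦ ⨆ i, |a i j * ξ i ω| with hG
  have hG0 : ∀ j ω, 0 ≤ G j ω := fun j ω ↦ iSup_abs_nonneg fun i ↦ a i j * ξ i ω
  have hGI : ∀ j, Integrable (G j) P₁ := fun j ↦
    integrable_iSup_abs (fun i ↦ (hξm i).const_mul _) fun i ↦ (hξI i).const_mul _
  have hNI := integrable_norm_toLp hp hGI
  -- Rescaling by `σ⁻¹` makes the stable variables standard, and `σ` factors out.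
  have hinner : ∀ ω₁, ∫ ω₂, maxProd a ξ η ω₁ ω₂ ∂P₂
      = σ * ∫ ω₂, ⨆ j, |G j ω₁ * (σ⁻¹ * η j ω₂)| ∂P₂ := by
    intro ω₁
    rw [← integral_const_mul]
    exact integral_congr_ae (ae_of_all _ fun ω₂ ↦ maxProd_eq_mul_iSup_inv_mul hσ a ξ η ω₁ ω₂)
  refine ⟨hint, ?_, ?_⟩
  · calc c₂ * c₁ * σ * ‖WithLp.toLp (ENNReal.ofReal p) b‖
        = c₂ * σ * (c₁ * ‖WithLp.toLp (ENNReal.ofReal p) b‖) := by ring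
      _ ≤ c₂ * σ * ‖WithLp.toLp (ENNReal.ofReal p) fun j ↦ ∫ ω, G j ω ∂P₁‖ := by
          refine mul_le_mul_of_nonneg_left (norm_toLp_le_mul hp hc₁.le fun j ↦ ?_) (by positivity)
          rw [abs_of_nonneg (hb0 j), abs_of_nonneg (integral_nonneg (hG0 j))]
          exact hgauss hξm hlaw hξind fun i ↦ a i j
      _ ≤ c₂ * σ * ∫ ω, ‖WithLp.toLp (ENNReal.ofReal p) fun j ↦ G j ω‖ ∂P₁ :=
          mul_le_mul_of_nonneg_left (norm_toLp_integral_le hp hGI) (by positivity)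
      _ ≤ ∫ ω₁, ∫ ω₂, maxProd a ξ η ω₁ ω₂ ∂P₂ ∂P₁ := by
          rw [← integral_const_mul]
          refine integral_mono (hNI.const_mul _) hint.integral_prod_left fun ω₁ ↦ ?_
          have h := hstable hη' hηind' fun j ↦ G j ω₁
          show c₂ * σ * ‖WithLp.toLp (ENNReal.ofReal p) fun j ↦ G j ω₁‖
            ≤ ∫ ω₂, maxProd a ξ η ω₁ ω₂ ∂P₂
          rw [hinner, norm_toLp_eq_sum hp, mul_comm c₂, mul_assoc]
          gcongr
  · calc ∫ ω₁, ∫ ω₂, maxProd a ξ η ω₁ ω₂ ∂P₂ ∂P₁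
        ≤ (1 + 8 / (p - 1)) * σ *
            ∫ ω, ‖WithLp.toLp (ENNReal.ofReal p) fun j ↦ G j ω‖ ∂P₁ := by
          rw [← integral_const_mul]
          refine integral_mono hint.integral_prod_left (hNI.const_mul _) fun ω₁ ↦ ?_
          have h := integral_iSup_stable_le hp hp' hη' fun j ↦ G j ω₁
          show ∫ ω₂, maxProd a ξ η ω₁ ω₂ ∂P₂
            ≤ (1 + 8 / (p - 1)) * σ * ‖WithLp.toLp (ENNReal.ofReal p) fun j ↦ G j ω₁‖
          rw [hinner, norm_toLp_eq_sum hp, mul_comm (1 + _), mul_assoc]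
          gcongr
      _ ≤ (1 + 8 / (p - 1)) * σ * (K ^ (1 / p) * ‖WithLp.toLp (ENNReal.ofReal p) b‖) := by
          -- The `p`-th power of the `ℓ_p` norm is additive over columns, so moment bounds for each
          -- single `G j` suffice, with no control of their joint law.
          have hmom := fun j ↦ integral_iSup_gaussian_rpow_le hp hp' hξm hlaw fun i ↦ a i j
          refine mul_le_mul_of_nonneg_left (integral_norm_toLp_le hp hGI (fun j ↦ ?_) hK.le
            fun j ↦ ?_) (by positivity)
          · simp only [abs_of_nonneg (hG0 j _)]
            exact (hmom j).1
          · simp only [abs_of_nonneg (hG0 j _), abs_of_nonneg (hb0 j)]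
            exact (hmom j).2
      _ = (1 + 8 / (p - 1)) * K ^ (1 / p) * σ * ‖WithLp.toLp (ENNReal.ofReal p) b‖ := by ring
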